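/- An inversion sequence of length $n\ge 0$ is an integer sequence $e=(e_1,\dots,e_n)$ with $0\le e_j\le j-1$ for all $j$. It avoids $102$ if there are no $i<j<k$ with $e_j<e_i<e_k$, and it avoids $000$ if there are no $i<j<k$ with $e_i=e_j=e_k$; it is $(102,000)$-avoiding if it avoids both. Let $\operatorname{dist}(e)=|\{e_i:1\le i\le n\}|$ be its number of distinct elements. Let $H=\{(0,1)\}\cup\{(a,b)\in\mathbb Z^2: a\ge 1,\ b\le 1\}\cup\{(0,b): b\in\mathbb Z,\ b\le -1\}$. A simple $H$-path of semilength $n$ is a lattice path with $n$ steps, all in $H$, that starts at the origin, does not go below the line $y=x$ (every lattice point $(x,y)$ it visits satisfies $x\le y$), and has no two consecutive steps of the form $(0,b)$, $(0,b')$. For $n\ge1$ and $m\ge0$ let $\mathcal B_n^{(m)}$ be the set of simple $H$-paths of semilength $n$ that have exactly $m$ steps $(a,b)$ with $a\ge1$, do not start with the north step $(0,1)$, and end with a north step $(0,1)$; by convention $\mathcal B_0^{(0)}$ consists of the trivial path only. Theorem. For every integer $m\ge 0$, both the cardinality of $\bigcup_{n=m}^{2m}\mathcal B_n^{(m)}$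 and the number of $(102,000)$-avoiding inversion sequences $e$, of arbitrary length, with $\operatorname{dist}(e)=m$ and $|\{p: e_p=\max(e)\}|=1$ (where for $m=0$ the empty sequence is counted by convention) are equal to the $3$-Fuss–Catalan number $$\frac{1}{3m+1}\binom{4m}{m}.$$ -/

import Mathlib

namespace InvSeq

/-- The reduction of a word `u`: the `i`-th smallest of the values occurring in `u` is replaced
by `i - 1`, i.e. every entry is replaced by the number of values of `u` smaller than it. -/
def reduction {k : ℕ} (u : Fin k → ℕ) : Fin k → ℕ :=
  fun a => ((Finset.univ.image u).filter (fun v => v < u a)).card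

/-- The sequence `e` contains the pattern `w`: some subsequence of `e` has reduction `w`. -/
def Contains {k n : ℕ} (w : Fin k → ℕ) (e : Fin n → ℕ) : Prop :=
  ∃ f : Fin k → Fin n, StrictMono f ∧ reduction (fun a => e (f a)) = w

/-- The sequence `e` avoids the pattern `w`. -/
def Avoids {k n : ℕ} (w : Fin k → ℕ) (e : Fin n → ℕ) : Prop := ¬ Contains w e

/-- Inversion sequences of length `n`: `0 ≤ e_j ≤ j - 1` for `j = 1, …, n`
(positions are numbered `0, …, n - 1` here). -/
def IsInversionSeq {n : ℕ} (e : Fin n → ℕ) : Prop := ∀ i : Fin n, e i ≤ (i : ℕ)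

/-- The set of `(102, 000)`-avoiding inversion sequences of length `n`. -/
def IS102000 (n : ℕ) : Set (Fin n → ℕ) :=
  {e | IsInversionSeq e ∧ Avoids ![1, 0, 2] e ∧ Avoids ![0, 0, 0] e}

/-- The number of distinct elements of a sequence. -/
def dist {n : ℕ} (e : Fin n → ℕ) : ℕ := (Finset.univ.image e).card

/-- The positions `p` at which `e_p = max e`. -/
def maxPositions {n : ℕ} (e : Fin n → ℕ) : Finset (Fin n) :=
  Finset.univ.filter (fun p => ∀ q, e q ≤ e p)

/-- The maximum element of `e` occurs exactly once; by convention the empty sequence, which has no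
maximum, is included. -/
def MaxOnce {n : ℕ} (e : Fin n → ℕ) : Prop := n = 0 ∨ (maxPositions e).card = 1

/-- The `(102, 000)`-avoiding inversion sequences, of arbitrary length, with `m` distinct elements
and whose maximum element occurs exactly once. -/
def maxOnceSeqs (m : ℕ) : Set (Σ n : ℕ, Fin n → ℕ) :=
  {e | e.2 ∈ IS102000 e.1 ∧ dist e.2 = m ∧ MaxOnce e.2}

end InvSeq

namespace HPath

/-- A north step. -/
def IsNorth (s : ℤ × ℤ) : Prop := s = (0, 1)

/-- A south step. -/
def IsSouth (s : ℤ × ℤ) : Prop := s.1 = 0 ∧ s.2 ≤ -1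

/-- An up step. -/
def IsUp (s : ℤ × ℤ) : Prop := 1 ≤ s.1 ∧ s.2 = 1

/-- A down step. -/
def IsDown (s : ℤ × ℤ) : Prop := 1 ≤ s.1 ∧ s.2 ≤ 0

/-- The step set `F = {(0, 1)} ∪ {(a, b) : a ≥ 1, b ≤ 1}`. -/
def stepsF : Set (ℤ × ℤ) := {(0, 1)} ∪ {s | 1 ≤ s.1 ∧ s.2 ≤ 1}

/-- The step set `H = F ∪ {(0, b) : b ≤ -1}`. -/
def stepsH : Set (ℤ × ℤ) := stepsF ∪ {s | s.1 = 0 ∧ s.2 ≤ -1}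

/-- `H`-walks. A walk starting at the origin is given by the list of its steps; the lattice points
it visits are the partial sums of that list. -/
def IsHWalk (R : List (ℤ × ℤ)) : Prop :=
  (∀ s ∈ R, s ∈ stepsH) ∧
  (∀ i ≤ R.length, (R.take i).sum.1 ≤ (R.take i).sum.2) ∧
  R.IsChain (fun s s' => IsNorth s → ¬ IsSouth s')

/-- Simple `H`-paths. Every step of a simple `H`-path has weight `1`, so weights are not recorded
and the semilength is the number of steps. -/
def IsSimple (R : List (ℤ × ℤ)) : Prop :=
  IsHWalk R ∧
  R.IsChain (fun s s' => IsNorth s ∨ IsSouth s → ¬ IsNorth s') ∧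
  R.IsChain (fun s s' => IsSouth s → ¬ IsSouth s')

/-- The height `y - x` of the last lattice point `(x, y)`. -/
def height (R : List (ℤ × ℤ)) : ℤ := R.sum.2 - R.sum.1

open Classical in
/-- The number of up steps plus the number of down steps. -/
noncomputable def ud (R : List (ℤ × ℤ)) : ℕ :=
  R.countP (fun s => IsUp s) + R.countP (fun s => IsDown s)

/-- The simple `H`-paths of semilength `n` and height `t` with `ud R = m`. -/
def simplePaths (n t m : ℕ) : Set (List (ℤ × ℤ)) :=
  {R | IsSimple R ∧ R.length = n ∧ height R = t ∧ ud R = m}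

/-- The paths in `simplePaths n t m` that do not start with the north step. -/
def pathsD (n t m : ℕ) : Set (List (ℤ × ℤ)) :=
  {R ∈ simplePaths n t m | ∀ s ∈ R.head?, ¬ IsNorth s}

/-- The simple `H`-paths of semilength `n`, of any height, with `ud R = m`, that do not start with
the north step and end with a north step. By convention the trivial path (`n = 0`), which has no
last step, is included. -/
def pathsB (n m : ℕ) : Set (List (ℤ × ℤ)) :=
  {R ∈ ⋃ t : ℕ, pathsD n t m | ∀ s ∈ R.getLast?, IsNorth s}

end HPath

/-! For `m = r + 1` both families have `stepOp^[r] (fun _ => 1) 0` elements, because each grows by a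
rule that depends on a single number.

Paths. The first step is forced to be `(1, 1)`, which ends at height `0`. The rest splits uniquely
into `r` blocks, each an optional vertical step and then a forward step, and a closing north step. A
block changes the height `h` by `1 - l - x - y` with `l, x, y ≥ 0`, and it stays above the line iff
`l + x + y ≤ h + 1`. Summing a function of the new height over all blocks is `stepOp` (`card_codes`,
`iUnion_pathsB_succ`).

Words. Deleting all copies of the maximum keeps a word admissible. Conversely, a new maximum `v ≥
bound L` goes in once or twice, at gaps between `v` and `prefLen L`. The slacks of the children
depend only on the slack of `L`. Write `P` for partial summation and `S` for the shift: summing over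
the children applies `P P S P` (`sum_choices_slack`), while `stepOp` is `S P P P`, so `(P P S P)^m P
P = P P stepOp^m`. The factor `P P` on the left counts single insertions of the last maximum; the
one on the right does nothing at `0`.

Closed form. Moving the partial sums from `f` onto ballot numbers evaluates the iterates
(`iterate_stepOp_zero`). -/

/-! ### Partial sums and the closed form -/

/-- Partial sums of a sequence. -/
def psum (f : ℕ → ℕ) (n : ℕ) : ℕ := ∑ i ∈ Finset.range (n + 1), f i

theorem psum_eq_reflect (f : ℕ → ℕ) (n : ℕ) :
    psum f n = ∑ i ∈ Finset.range (n + 1), f (n - i) :=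
  (Finset.sum_range_reflect f (n + 1)).symm.trans
    (Finset.sum_congr rfl fun i _ => by congr 1)

/-- Three partial sums followed by a shift. -/
def stepOp (f : ℕ → ℕ) (h : ℕ) : ℕ := psum (psum (psum f)) (h + 1)

/-- The number of lattice paths from the origin to `(c, u)` that stay in `{(x, y) | 3 * y ≤ x}`,
provided that `3 * u ≤ c + 1`. -/
def ballot (c u : ℕ) : ℤ := (c + u).choose c - 3 * (c + u).choose (c + 1)

theorem sum_ballot (c w : ℕ) :
    ∑ u ∈ Finset.range (w + 1), ballot c u = ballot (c + 1) w := by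
  induction w with
  | zero => simp [ballot]
  | succ w ih =>
    rw [Finset.sum_range_succ, ih]
    have h1 := Nat.choose_succ_succ (c + w + 1) c
    have h2 := Nat.choose_succ_succ (c + w + 1) (c + 1)
    simp only [ballot, Nat.succ_eq_add_one] at *
    rw [show c + 1 + (w + 1) = c + w + 1 + 1 by ring, show c + 1 + w = c + w + 1 by ring,
      show c + (w + 1) = c + w + 1 by ring, h1, h2]
    push_cast
    ring

theorem three_mul_choose (j : ℕ) :
    3 * (4 * j + 3).choose (3 * j + 3) = (4 * j + 3).choose (3 * j + 2) := by
  have h := Nat.choose_succ_right_eq (4 * j + 3) (3 * j + 2)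
  rw [show 4 * j + 3 - (3 * j + 2) = j + 1 by omega] at h
  have : (j + 1) * (3 * (4 * j + 3).choose (3 * j + 3))
      = (j + 1) * (4 * j + 3).choose (3 * j + 2) := by
    rw [mul_comm (j + 1) ((4 * j + 3).choose (3 * j + 2)), ← h]
    ring
  exact Nat.eq_of_mul_eq_mul_left (Nat.succ_pos j) this

/-- The point `(3 * j + 2, j + 1)` lies just outside the region `3 * y ≤ x`. This zero later allows
a sum to be lengthened by one term. -/
theorem ballot_boundary (j : ℕ) : ballot (3 * j + 2) (j + 1) = 0 := by
  have h := three_mul_choose j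
  rw [ballot, show 3 * j + 2 + (j + 1) = 4 * j + 3 by ring, ← h]
  push_cast
  ring

/-- Partial summation is convolution with the constant `1`, so it can be moved from `f` to the
ballot factor, where `sum_ballot` evaluates it. -/
theorem sum_ballot_mul_psum (c k : ℕ) (f : ℕ → ℕ) :
    ∑ u ∈ Finset.range (k + 1), ballot c u * (psum f (k - u) : ℤ)
      = ∑ u ∈ Finset.range (k + 1), ballot (c + 1) u * (f (k - u) : ℤ) := by
  induction k generalizing f with
  | zero => simp [psum, ballot]
  | succ k ih =>
    have key : ∀ u ∈ Finset.range (k + 1), ballot c u * (psum f (k + 1 - u) : ℤ)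
        = ballot c u * (psum (fun i => f (i + 1)) (k - u) : ℤ) + ballot c u * f 0 := by
      intro u hu
      rw [Finset.mem_range] at hu
      rw [show k + 1 - u = k - u + 1 by omega, psum, Finset.sum_range_succ', psum]
      push_cast
      ring
    rw [Finset.sum_range_succ, Finset.sum_congr rfl key, Finset.sum_add_distrib, ih,
      Finset.sum_range_succ _ (k + 1), ← sum_ballot c (k + 1), Finset.sum_range_succ _ (k + 1),
      ← Finset.sum_mul]
    have : ∀ u ∈ Finset.range (k + 1), ballot (c + 1) u * (f (k + 1 - u) : ℤ)
        = ballot (c + 1) u * (f (k - u + 1) : ℤ) := by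
      intro u hu
      rw [Finset.mem_range] at hu
      rw [show k + 1 - u = k - u + 1 by omega]
    rw [Finset.sum_congr rfl this]
    simp [psum]
    ring

/-- The induction hypothesis is used for `stepOp f`. The shift turns `j - u` into `j + 1 - u`,
`ballot_boundary` supplies the missing term `u = j + 1`, and the three partial sums raise the first
ballot index by `3`. -/
theorem iterate_stepOp_zero (j : ℕ) (f : ℕ → ℕ) :
    ((stepOp^[j] f 0 : ℕ) : ℤ)
      = ∑ u ∈ Finset.range (j + 1), ballot (3 * j + 2) u * (f (j - u) : ℤ) := by
  induction j generalizing f with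
  | zero => simp [ballot]
  | succ j ih =>
    rw [Function.iterate_succ_apply, ih]
    have : ∀ u ∈ Finset.range (j + 1), ballot (3 * j + 2) u * (stepOp f (j - u) : ℤ)
        = ballot (3 * j + 2) u * (psum (psum (psum f)) (j + 1 - u) : ℤ) := by
      intro u hu
      rw [Finset.mem_range] at hu
      rw [stepOp, show j - u + 1 = j + 1 - u by omega]
    rw [Finset.sum_congr rfl this]
    have h0 := sum_ballot_mul_psum (3 * j + 2) (j + 1) (psum (psum f))
    rw [Finset.sum_range_succ, ballot_boundary, zero_mul, add_zero] at h0
    rw [h0, sum_ballot_mul_psum, sum_ballot_mul_psum]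
    rfl

theorem iterate_stepOp_one (r : ℕ) :
    ((stepOp^[r] (fun _ => 1) 0 : ℕ) : ℚ)
      = 1 / (3 * ((r + 1 : ℕ) : ℚ) + 1) * ((4 * (r + 1)).choose (r + 1) : ℚ) := by
  have h := iterate_stepOp_zero r (fun _ => 1)
  simp only [Nat.cast_one, mul_one, sum_ballot] at h
  rw [ballot, show 3 * r + 2 + 1 + r = 4 * r + 3 by ring] at h
  have h3 := three_mul_choose r
  have h4 := Nat.choose_succ_right_eq (4 * r + 3) (3 * r + 3)
  rw [show 4 * r + 3 - (3 * r + 3) = r by omega] at h4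
  have h5 : (4 * (r + 1)).choose (r + 1) = 4 * (4 * r + 3).choose (3 * r + 3) := by
    rw [← Nat.choose_symm_of_eq_add (show 4 * (r + 1) = (3 * r + 2 + 1) + (r + 1) by ring),
      show 4 * (r + 1) = 4 * r + 3 + 1 by ring, Nat.choose_succ_succ, ← h3]
    ring
  have hq : ((stepOp^[r] (fun _ => 1) 0 : ℕ) : ℚ)
      = (4 * r + 3).choose (3 * r + 3) - 3 * (4 * r + 3).choose (3 * r + 4) := by
    exact_mod_cast h
  have h4q : ((4 * r + 3).choose (3 * r + 4) : ℚ) * (3 * r + 4)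
      = (4 * r + 3).choose (3 * r + 3) * r := by exact_mod_cast h4
  rw [hq, h5]
  push_cast
  have : (3 * ((r : ℚ) + 1) + 1) ≠ 0 := by positivity
  field_simp
  linear_combination (-3) * h4q

/-! ### Encoding of the lattice paths -/

namespace HPath

/-- The vertical step of height `1 - l`, omitted when it is trivial. -/
def vert (l : ℕ) : List (ℤ × ℤ) := if l = 1 then [] else [(0, 1 - (l : ℤ))]

/-- The path that reads every triple `(l, x, y)` as a vertical step `(0, 1 - l)` followed by the
step `(1 + x, 1 - y)`, and ends with a north step. -/
def build : List (ℕ × ℕ × ℕ) → List (ℤ × ℤ)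
  | [] => [(0, 1)]
  | (l, x, y) :: t => vert l ++ (1 + (x : ℤ), 1 - (y : ℤ)) :: build t

/-- The path encoded by a list of triples does not go below height `0` when it starts at
height `h`. -/
def Fits : ℕ → List (ℕ × ℕ × ℕ) → Prop
  | _, [] => True
  | h, (l, x, y) :: t => l + x + y ≤ h + 1 ∧ Fits (h + 1 - l - x - y) t

/-- The lists of `r` triples that fit above a starting height. -/
def codes : ℕ → ℕ → Finset (List (ℕ × ℕ × ℕ))
  | 0, _ => {[]}
  | r + 1, h =>
    ((Finset.range (h + 1 + 1)).sigma fun l => (Finset.range (h + 1 - l + 1)).sigma fun x =>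
      (Finset.range (h + 1 - l - x + 1)).sigma fun y => codes r (h + 1 - l - x - y)).image
      fun p => (p.1, p.2.1, p.2.2.1) :: p.2.2.2

theorem mem_codes (r h : ℕ) (t : List (ℕ × ℕ × ℕ)) :
    t ∈ codes r h ↔ t.length = r ∧ Fits h t := by
  induction r generalizing h t with
  | zero =>
    rw [codes, Finset.mem_singleton, List.length_eq_zero_iff]
    constructor
    · rintro rfl
      exact ⟨rfl, trivial⟩
    · exact And.left
  | succ r ih =>
    rw [codes, Finset.mem_image]
    constructor
    · rintro ⟨⟨l, x, y, t⟩, h1, rfl⟩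
      simp only [Finset.mem_sigma, Finset.mem_range, ih] at h1
      obtain ⟨i1, i2, i3, i4, i5⟩ := h1
      exact ⟨by simp [i4], (by omega : l + x + y ≤ h + 1), i5⟩
    · rintro ⟨h1, h2⟩
      match t, h1, h2 with
      | (l, x, y) :: t, h1, h2 =>
        refine ⟨⟨l, x, y, t⟩, ?_, rfl⟩
        simp only [Finset.mem_sigma, Finset.mem_range, ih]
        have := h2.1
        exact ⟨by omega, by omega, by omega, by simpa using h1, h2.2⟩

/-- The nested sums over `l`, `x`, `y` are the three partial sums of `stepOp`, indexed by the height
used up instead of the height left. -/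
theorem card_codes (r h : ℕ) : (codes r h).card = stepOp^[r] (fun _ => 1) h := by
  induction r generalizing h with
  | zero => rfl
  | succ r ih =>
    rw [codes, Finset.card_image_of_injective, Function.iterate_succ_apply', stepOp,
      psum_eq_reflect]
    · simp only [Finset.card_sigma, ih, psum_eq_reflect]
    · rintro ⟨l, x, y, t⟩ ⟨l', x', y', t'⟩ heq
      simp only [List.cons.injEq, Prod.mk.injEq] at heq
      obtain ⟨⟨rfl, rfl, rfl⟩, rfl⟩ := heq
      rfl

theorem build_ne_nil (t : List (ℕ × ℕ × ℕ)) : build t ≠ [] := by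
  match t with
  | [] => simp [build]
  | (l, x, y) :: t => simp [build]

/-- Vertical steps have first coordinate `0` and forward steps at least `1`, so the block boundaries
can be read off; only the closing north step has no successor. -/
theorem build_injective : Function.Injective build := by
  intro t
  induction t with
  | nil =>
    intro t' h
    match t', h with
    | [], _ => rfl
    | (l, x, y) :: t', h =>
      have h2 := build_ne_nil t'
      simp only [build, vert] at h
      split_ifs at h <;> simp_all
  | cons p t ih =>
    obtain ⟨l, x, y⟩ := p
    intro t' h
    match t', h with
    | [], h =>
      have h2 := build_ne_nil t
      simp only [build, vert] at h
      split_ifs at h <;> simp_all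
    | (l', x', y') :: t', h =>
      simp only [build, vert] at h
      split_ifs at h with h1 h2 h2
      · simp only [List.nil_append, List.cons.injEq, Prod.mk.injEq] at h
        rw [ih h.2, h1, h2, show x = x' by omega, show y = y' by omega]
      · simp at h
        omega
      · simp at h
        omega
      · simp only [List.cons_append, List.nil_append, List.cons.injEq, Prod.mk.injEq] at h
        rw [ih h.2.2, show l = l' by omega, show x = x' by omega, show y = y' by omega]

theorem length_build (t : List (ℕ × ℕ × ℕ)) :
    t.length + 1 ≤ (build t).length ∧ (build t).length ≤ 2 * t.length + 1 := by
  induction t with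
  | nil => simp [build]
  | cons p t ih =>
    obtain ⟨l, x, y⟩ := p
    simp only [build, vert, List.length_append, List.length_cons]
    split_ifs <;> simp <;> omega

/-! ### Walks read from an arbitrary height -/

/-- A list of steps of `H` that may be read from height `h` on, with no two consecutive vertical
steps. -/
def IsTail (h : ℤ) (L : List (ℤ × ℤ)) : Prop :=
  (∀ s ∈ L, s ∈ stepsH) ∧ (∀ i ≤ L.length, 0 ≤ h + height (L.take i)) ∧
  L.IsChain (fun s s' => ¬ (s.1 = 0 ∧ s'.1 = 0))

theorem isTail_nil (h : ℤ) : IsTail h [] ↔ 0 ≤ h := by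
  simp [IsTail, height]

theorem isTail_cons (h : ℤ) (s : ℤ × ℤ) (L : List (ℤ × ℤ)) :
    IsTail h (s :: L) ↔ s ∈ stepsH ∧ 0 ≤ h ∧ (∀ s' ∈ L.head?, ¬ (s.1 = 0 ∧ s'.1 = 0)) ∧
      IsTail (h + s.2 - s.1) L := by
  have hh : ∀ i, height ((s :: L).take (i + 1)) = s.2 - s.1 + height (L.take i) := by
    intro i
    simp only [height, List.take_succ_cons, List.sum_cons, Prod.fst_add, Prod.snd_add]
    ring
  have h2 : (∀ i ≤ (s :: L).length, 0 ≤ h + height ((s :: L).take i)) ↔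
      0 ≤ h ∧ ∀ i ≤ L.length, 0 ≤ h + s.2 - s.1 + height (L.take i) := by
    constructor
    · intro H
      refine ⟨by simpa [height] using H 0 (Nat.zero_le _), fun i hi => ?_⟩
      have := H (i + 1) (by simpa using hi)
      rw [hh] at this
      linarith
    · rintro ⟨H0, H⟩ i hi
      match i, hi with
      | 0, _ => simpa [height] using H0
      | i + 1, hi =>
        have := H i (by simpa using hi)
        rw [hh]
        linarith
  rw [IsTail, IsTail, h2, List.isChain_cons, List.forall_mem_cons]
  tauto

theorem IsTail.nonneg {h : ℤ} {L : List (ℤ × ℤ)} (H : IsTail h L) : 0 ≤ h := by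
  simpa [height] using H.2.1 0 (Nat.zero_le _)

theorem mem_stepsH (s : ℤ × ℤ) :
    s ∈ stepsH ↔ (s.1 = 0 ∧ s.2 ≤ 1 ∧ s.2 ≠ 0) ∨ (1 ≤ s.1 ∧ s.2 ≤ 1) := by
  obtain ⟨a, b⟩ := s
  simp only [stepsH, stepsF, Set.mem_union, Set.mem_singleton_iff, Set.mem_ofPred_eq, Prod.mk.injEq]
  omega

/-- A step of `H` with first coordinate `0` is north or south, and the three chain conditions
together exclude all four ordered pairs of such steps. -/
theorem isSimple_iff (R : List (ℤ × ℤ)) : IsSimple R ↔ IsTail 0 R := by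
  rw [IsSimple, IsHWalk, IsTail]
  have h1 : (∀ i ≤ R.length, (R.take i).sum.1 ≤ (R.take i).sum.2) ↔
      ∀ i ≤ R.length, 0 ≤ 0 + height (R.take i) := by
    simp [height]
  rw [h1]
  have h2 : (∀ s ∈ R, s ∈ stepsH) → ((R.IsChain (fun s s' => IsNorth s → ¬ IsSouth s') ∧
      R.IsChain (fun s s' => IsNorth s ∨ IsSouth s → ¬ IsNorth s') ∧
      R.IsChain (fun s s' => IsSouth s → ¬ IsSouth s')) ↔
      R.IsChain (fun s s' => ¬ (s.1 = 0 ∧ s'.1 = 0))) := by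
    intro H
    have hv : ∀ s ∈ R, (IsNorth s ∨ IsSouth s) ↔ s.1 = 0 := by
      intro s hs
      have := (mem_stepsH s).1 (H s hs)
      obtain ⟨a, b⟩ := s
      simp only [IsNorth, IsSouth, Prod.mk.injEq] at *
      omega
    simp only [List.isChain_iff_getElem]
    constructor
    · rintro ⟨a, b, c⟩ i hi
      have a := a i hi
      have b := b i hi
      have c := c i hi
      rw [← hv _ (List.getElem_mem _), ← hv _ (List.getElem_mem _)]
      tauto
    · intro a
      have key : ∀ (i : ℕ) (hi : i + 1 < R.length), ¬ ((IsNorth R[i] ∨ IsSouth R[i]) ∧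
          (IsNorth R[i + 1] ∨ IsSouth R[i + 1])) := by
        intro i hi
        rw [hv _ (List.getElem_mem _), hv _ (List.getElem_mem _)]
        exact a i hi
      refine ⟨fun i hi => ?_, fun i hi => ?_, fun i hi => ?_⟩ <;>
      · have := key i hi
        tauto
  tauto

theorem ud_nil : ud [] = 0 := by simp [ud]

theorem ud_cons_vertical {s : ℤ × ℤ} (hs : s.1 = 0) (L : List (ℤ × ℤ)) : ud (s :: L) = ud L := by
  simp [ud, IsUp, IsDown, hs]

theorem ud_cons_forward {s : ℤ × ℤ} (hs : 1 ≤ s.1) (hs' : s.2 ≤ 1) (L : List (ℤ × ℤ)) :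
    ud (s :: L) = ud L + 1 := by
  by_cases h : s.2 = 1
  · simp [ud, IsUp, IsDown, hs, h]
    omega
  · have : s.2 ≤ 0 := by omega
    simp [ud, IsUp, IsDown, hs, h, this]
    omega

theorem isTail_build (t : List (ℕ × ℕ × ℕ)) (h : ℕ) (ht : Fits h t) :
    IsTail h (build t) ∧ ud (build t) = t.length ∧ ∀ s ∈ (build t).getLast?, s = (0, 1) := by
  induction t generalizing h with
  | nil =>
    simp [build, isTail_cons, isTail_nil, mem_stepsH, ud_cons_vertical, ud_nil]
    omega
  | cons p t ih =>
    obtain ⟨l, x, y⟩ := p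
    obtain ⟨h1, h2⟩ := ht
    obtain ⟨i1, i2, i3⟩ := ih _ h2
    have i4 : ((h + 1 - l - x - y : ℕ) : ℤ) = h + (1 - l) + (1 - y) - (1 + x) := by omega
    have hu : ud ((1 + (x : ℤ), 1 - (y : ℤ)) :: build t) = t.length + 1 := by
      rw [ud_cons_forward (by simp) (by simp), i2]
    have hT : IsTail (h + (1 - l)) ((1 + (x : ℤ), 1 - (y : ℤ)) :: build t) := by
      rw [isTail_cons, mem_stepsH, ← i4]
      refine ⟨Or.inr ⟨by simp, by simp⟩, by omega, fun s' _ hs => ?_, i1⟩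
      have := hs.1
      simp only at this
      omega
    have hl : ∀ s ∈ ((1 + (x : ℤ), 1 - (y : ℤ)) :: build t).getLast?, s = (0, 1) := by
      obtain ⟨a, u, e⟩ := List.exists_cons_of_ne_nil (build_ne_nil t)
      rw [e] at i3 ⊢
      rwa [List.getLast?_cons_cons]
    simp only [build, vert]
    split_ifs with hl1
    · subst hl1
      rw [Nat.cast_one, sub_self, add_zero] at hT
      exact ⟨hT, hu, hl⟩
    · refine ⟨?_, ?_, ?_⟩
      · rw [List.singleton_append, isTail_cons, mem_stepsH]
        refine ⟨Or.inl ⟨rfl, by simp, by simp; omega⟩, by omega, ?_, by simpa using hT⟩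
        intro s' hs' hs
        simp only [List.head?_cons, Option.mem_def, Option.some.injEq] at hs'
        have := hs.2
        rw [← hs'] at this
        simp only at this
        omega
      · rw [List.singleton_append, ud_cons_vertical rfl, hu]
        rfl
      · rw [List.singleton_append, List.getLast?_cons_cons]
        exact hl

/-- The induction is on a bound for the length, since splitting off a block removes one or two
steps. -/
theorem exists_build (n : ℕ) (L : List (ℤ × ℤ)) (hn : L.length ≤ n) (h : ℕ) (hL : IsTail h L)
    (h0 : L ≠ []) (hl : ∀ s ∈ L.getLast?, s = (0, 1)) :
    ∃ t, Fits h t ∧ build t = L := by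
  induction n generalizing L h with
  | zero => exact absurd (List.length_eq_zero_iff.1 (by omega)) h0
  | succ n ih =>
    -- The forward step of a block, with or without a vertical step before it. It cannot be the last
    -- step, which is north, so the induction hypothesis applies to `M`.
    have forward : ∀ (s : ℤ × ℤ) (M : List (ℤ × ℤ)) (k : ℤ), 1 ≤ s.1 → s.2 ≤ 1 →
        M.length ≤ n → IsTail k (s :: M) → (∀ a ∈ (s :: M).getLast?, a = (0, 1)) →
        ∃ (x y : ℕ) (t : List (ℕ × ℕ × ℕ)), (x + y : ℤ) ≤ k ∧ Fits (k - x - y).toNat t ∧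
          s :: M = (1 + (x : ℤ), 1 - (y : ℤ)) :: build t := by
      intro s M k hs hs' hM hT hlast
      rw [isTail_cons] at hT
      have hk := hT.2.2.2.nonneg
      have e : k + s.2 - s.1 = ((k - (s.1 - 1).toNat - (1 - s.2).toNat).toNat : ℕ) := by omega
      have hM0 : M ≠ [] := by
        rintro rfl
        have := hlast s (by simp)
        rw [this] at hs
        norm_num at hs
      have hlM : ∀ a ∈ M.getLast?, a = (0, 1) := by
        obtain ⟨a, u, rfl⟩ := List.exists_cons_of_ne_nil hM0
        rwa [List.getLast?_cons_cons] at hlast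
      obtain ⟨t, ht, rfl⟩ := ih M hM _ (e ▸ hT.2.2.2) hM0 hlM
      refine ⟨(s.1 - 1).toNat, (1 - s.2).toNat, t, by omega, ht, ?_⟩
      congr 1
      ext <;> simp only <;> omega
    obtain ⟨s, M, rfl⟩ := List.exists_cons_of_ne_nil h0
    have hT := hL
    rw [isTail_cons, mem_stepsH] at hL
    obtain ⟨hs, -, hc, hM⟩ := hL
    simp only [List.length_cons] at hn
    rcases hs with ⟨hs1, hs2, hs3⟩ | ⟨hs1, hs2⟩
    · match M, hc, hM, hn, hl, hT with
      | [], _, _, _, hl, _ =>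
        have := hl s (by simp)
        exact ⟨[], trivial, by rw [this]; rfl⟩
      | s' :: M, hc, hM, hn, hl, _ =>
        have hs' : ¬ s'.1 = 0 := fun hs' => hc s' (by simp) ⟨hs1, hs'⟩
        have hs'' := (mem_stepsH s').1 ((isTail_cons _ _ _).1 hM).1
        have hn0 := hM.nonneg
        rw [List.getLast?_cons_cons] at hl
        obtain ⟨x, y, t, h1, h2, h3⟩ := forward s' M _ (by omega) (by omega)
          (by simp only [List.length_cons] at hn; omega) hM hl
        refine ⟨((1 - s.2).toNat, x, y) :: t, ⟨by omega, ?_⟩, ?_⟩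
        · convert h2 using 1
          omega
        · rw [h3, build, vert, if_neg (by omega), List.singleton_append]
          congr 1
          ext <;> simp only <;> omega
    · obtain ⟨x, y, t, h1, h2, h3⟩ := forward s M _ hs1 hs2 (by omega) hT hl
      refine ⟨(1, x, y) :: t, ⟨by omega, ?_⟩, ?_⟩
      · convert h2 using 1
        omega
      · rw [h3, build, vert, if_pos rfl, List.nil_append]

/-- The range of `n` is no restriction: by `length_build`, a path with `r + 1` forward steps has
between `r + 2` and `2 * (r + 1)` steps. -/
theorem iUnion_pathsB_succ (r : ℕ) :
    (⋃ n ∈ Set.Icc (r + 1) (2 * (r + 1)), pathsB n (r + 1))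
      = (fun t => (1, 1) :: build t) '' (codes r 0 : Set (List (ℕ × ℕ × ℕ))) := by
  ext R
  simp only [Set.mem_iUnion, pathsB, pathsD, simplePaths, Set.mem_ofPred_eq, Set.mem_image,
    Finset.mem_coe, mem_codes, isSimple_iff, Set.mem_Icc, exists_prop]
  constructor
  · rintro ⟨n, hn, ⟨t, ⟨hT, hlen, -, hud⟩, hhead⟩, hlast⟩
    have hR : R ≠ [] := by
      rintro rfl
      simp at hlen
      omega
    obtain ⟨s, L, rfl⟩ := List.exists_cons_of_ne_nil hR
    rw [isTail_cons, mem_stepsH] at hT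
    obtain ⟨hs, -, -, hL⟩ := hT
    have hk := hL.nonneg
    have hn' : ¬ IsNorth s := hhead s (by simp)
    -- From height `0` a south step goes below the line, and a forward step `(a, b)` with `b ≤ 1 ≤
    -- a` stays above it only if `a = b = 1`.
    have hs11 : s = (1, 1) := by
      obtain ⟨a, b⟩ := s
      simp only [IsNorth, Prod.mk.injEq] at *
      omega
    subst hs11
    have hL0 : L ≠ [] := by
      rintro rfl
      have := hlast (1, 1) (by simp)
      simp [IsNorth] at this
    have hl : ∀ a ∈ L.getLast?, a = (0, 1) := by
      obtain ⟨a, u, rfl⟩ := List.exists_cons_of_ne_nil hL0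
      rwa [List.getLast?_cons_cons] at hlast
    obtain ⟨c, hc, rfl⟩ := exists_build _ L le_rfl 0 (by simpa using hL) hL0 hl
    refine ⟨c, ⟨?_, hc⟩, rfl⟩
    rw [ud_cons_forward (by simp) (by simp), (isTail_build c 0 hc).2.1] at hud
    omega
  · rintro ⟨c, ⟨hlen, hc⟩, rfl⟩
    obtain ⟨h1, h2, h3⟩ := isTail_build c 0 hc
    have h4 := length_build c
    have hT : IsTail 0 ((1, 1) :: build c) := by
      rw [isTail_cons, mem_stepsH]
      refine ⟨by simp, le_rfl, by simp, by simpa using h1⟩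
    refine ⟨_, ?_, ⟨(height ((1, 1) :: build c)).toNat, ⟨hT, rfl, ?_, ?_⟩, ?_⟩, ?_⟩
    · simp only [List.length_cons]
      omega
    · have := hT.2.1 _ le_rfl
      rw [List.take_length] at this
      omega
    · rw [ud_cons_forward (by simp) (by simp), h2, hlen]
    · simp [IsNorth]
    · obtain ⟨a, u, e⟩ := List.exists_cons_of_ne_nil (build_ne_nil c)
      rw [e] at h3 ⊢
      rwa [List.getLast?_cons_cons]

theorem ncard_iUnion_pathsB_succ (r : ℕ) :
    (⋃ n ∈ Set.Icc (r + 1) (2 * (r + 1)), pathsB n (r + 1)).ncard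
      = stepOp^[r] (fun _ => 1) 0 := by
  rw [iUnion_pathsB_succ, Set.ncard_image_of_injective, Set.ncard_coe_finset, card_codes]
  intro t t' h
  exact build_injective (List.cons.inj h).2

theorem ncard_iUnion_pathsB_zero :
    (⋃ n ∈ Set.Icc 0 (2 * 0), pathsB n 0).ncard = 1 := by
  rw [Set.ncard_eq_one]
  refine ⟨[], ?_⟩
  ext R
  simp only [Set.mem_iUnion, pathsB, pathsD, simplePaths, Set.mem_ofPred_eq, isSimple_iff,
    Set.mem_Icc, exists_prop, Set.mem_singleton_iff]
  constructor
  · rintro ⟨n, hn, ⟨t, ⟨-, hlen, -⟩, -⟩, -⟩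
    exact List.length_eq_zero_iff.1 (by omega)
  · rintro rfl
    exact ⟨0, by simp, ⟨0, ⟨by simp [isTail_nil], rfl, by simp [height], ud_nil⟩, by simp⟩, by simp⟩

end HPath

/-! ### Inversion sequences as words -/

namespace InvSeq

/-- The least upper bound of the numbers `x + 1` for `x` in `L`. -/
def bound (L : List ℕ) : ℕ := L.foldr (fun x b => max (x + 1) b) 0

theorem bound_le_iff (L : List ℕ) (b : ℕ) : bound L ≤ b ↔ ∀ x ∈ L, x < b := by
  induction L with
  | nil => simp [bound]
  | cons a L ih =>
    have : bound (a :: L) = max (a + 1) (bound L) := rfl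
    rw [this, max_le_iff, ih, List.forall_mem_cons, Nat.succ_le_iff]

theorem bound_eq {L : List ℕ} {v : ℕ} (h : v ∈ L) (h' : ∀ x ∈ L, x ≤ v) : bound L = v + 1 :=
  le_antisymm ((bound_le_iff _ _).2 fun x hx => Nat.lt_succ_of_le (h' x hx))
    ((bound_le_iff _ _).1 le_rfl v h)

theorem exists_max {L : List ℕ} (h : L ≠ []) : ∃ v ∈ L, ∀ x ∈ L, x ≤ v := by
  obtain ⟨v, hv, hv'⟩ := L.toFinset.exists_max_image id (by simpa using h)
  exact ⟨v, by simpa using hv, fun x hx => hv' x (by simpa using hx)⟩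

/-- The length of the longest weakly increasing prefix. -/
def prefLen (L : List ℕ) : ℕ :=
  Nat.findGreatest (fun k => (L.take k).Pairwise (· ≤ ·)) L.length

theorem prefLen_le_length (L : List ℕ) : prefLen L ≤ L.length := Nat.findGreatest_le _

theorem pairwise_take_iff {L : List ℕ} {g : ℕ} (hg : g ≤ L.length) :
    (L.take g).Pairwise (· ≤ ·) ↔ g ≤ prefLen L := by
  constructor
  · exact fun h => Nat.le_findGreatest hg h
  · intro h
    have h0 : (L.take (prefLen L)).Pairwise (· ≤ ·) :=
      Nat.findGreatest_spec (P := fun k => (L.take k).Pairwise (· ≤ ·)) (Nat.zero_le _) (by simp)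
    exact h0.sublist (List.take_sublist_take_left h)

theorem prefLen_append {A B : List ℕ} (hA : A.Pairwise (· ≤ ·))
    (hB : ∀ b ∈ B.head?, ∃ a ∈ A, b < a) : prefLen (A ++ B) = A.length := by
  apply le_antisymm
  · by_contra! h
    have hle : A.length + 1 ≤ (A ++ B).length := (Nat.succ_le_of_lt h).trans (prefLen_le_length _)
    have h2 := (pairwise_take_iff hle).2 h
    match B, hB, hle, h2 with
    | [], _, hle, _ => simp at hle
    | b :: B, hB, _, h2 =>
      obtain ⟨a, ha, hab⟩ := hB b (by simp)
      rw [List.take_append, List.take_of_length_le (by omega), Nat.add_sub_cancel_left,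
        List.pairwise_append] at h2
      exact absurd (h2.2.2 a ha b (by simp)) (by omega)
  · rw [← pairwise_take_iff (by simp)]
    simpa using hA

/-! ### Deleting the maximum from an admissible word -/

/-- The words of the inversion sequences that avoid `102` and `000`. -/
structure Admissible (L : List ℕ) : Prop where
  le_index : ∀ (i : ℕ) (hi : i < L.length), L[i] ≤ i
  avoids : ∀ a b c, [a, b, c].Sublist L → b < a → a < c → False
  count_le : ∀ x, L.count x ≤ 2

theorem admissible_nil : Admissible [] :=
  ⟨fun _ hi => absurd hi (Nat.not_lt_zero _), by simp, by simp⟩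

/-- Every letter of `R` stands at an index at least `A.length`. Inserting or deleting a maximum `v ≤
A.length` behind `A` thus cannot break the bound for the shifted letters. -/
theorem le_index_append_iff {A R : List ℕ} (h : ∀ r ∈ R, r ≤ A.length) :
    (∀ (i : ℕ) (hi : i < (A ++ R).length), (A ++ R)[i] ≤ i) ↔
      ∀ (i : ℕ) (hi : i < A.length), A[i] ≤ i := by
  constructor
  · intro H i hi
    have := H i (by simp; omega)
    rwa [List.getElem_append_left hi] at this
  · intro H i hi
    rw [List.getElem_append]
    split_ifs with h1
    · exact H i h1
    · exact (h _ (List.getElem_mem _)).trans (by omega)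

theorem pair_sublist_of_sublist_append {X Y : List ℕ} {a b v : ℕ} (hv : v ∉ Y)
    (h : [a, b, v].Sublist (X ++ v :: Y)) : [a, b].Sublist X := by
  -- Reversal makes the last copy of `v` the first one, so that induction on the letters before it
  -- works.
  have h1 : [v, b, a].Sublist (Y.reverse ++ v :: X.reverse) := by simpa using h.reverse
  have h2 : [b, a].Sublist X.reverse := by
    have hv' : v ∉ Y.reverse := by simpa using hv
    generalize Y.reverse = Z at h1 hv'
    induction Z with
    | nil => exact List.cons_sublist_cons.1 h1
    | cons z Z ih =>
      rw [List.mem_cons, not_or] at hv'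
      rw [List.cons_append] at h1
      rcases List.sublist_cons_iff.1 h1 with h1 | ⟨r, hr, -⟩
      · exact ih h1 hv'.2
      · exact absurd (List.cons.inj hr).1 hv'.1
  simpa using h2.reverse

/-- A copy of the maximum can only play the `2` of `102`, and the last copy, displayed between `X`
and `Y`, has the most letters before it. Hence those letters, other than `v`, must not descend. -/
theorem avoids_iff {X Y : List ℕ} {v : ℕ} (hX : ∀ x ∈ X, x ≤ v) (hY : ∀ y ∈ Y, y < v) :
    (∀ a b c, [a, b, c].Sublist (X ++ v :: Y) → b < a → a < c → False) ↔
      (∀ a b c, [a, b, c].Sublist ((X ++ v :: Y).filter (· ≠ v)) → b < a → a < c → False) ∧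
        (X.filter (· ≠ v)).Pairwise (· ≤ ·) := by
  have hle : ∀ x ∈ X ++ v :: Y, x ≤ v := by
    intro x hx
    rw [List.mem_append, List.mem_cons] at hx
    rcases hx with h | h | h
    · exact hX x h
    · exact h.le
    · exact (hY x h).le
  constructor
  · intro H
    refine ⟨fun a b c h => H a b c (h.trans List.filter_sublist), ?_⟩
    rw [List.pairwise_iff_forall_sublist]
    intro a b hab
    by_contra! hlt
    have ha := List.mem_filter.1 (hab.subset (by simp : a ∈ [a, b]))
    refine H a b v ?_ hlt (lt_of_le_of_ne (hX a ha.1) (by simpa using ha.2))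
    have := (hab.trans List.filter_sublist).append
      (List.cons_sublist_cons.2 (List.nil_sublist Y) : [v].Sublist (v :: Y))
    simpa using this
  · rintro ⟨H1, H2⟩ a b c h hba hac
    have hc := hle c (h.subset (by simp))
    have hav : a ≠ v := by omega
    have hbv : b ≠ v := by omega
    by_cases hcv : c = v
    · subst hcv
      have h1 := (pair_sublist_of_sublist_append (fun hy => (hY c hy).false) h).filter (· ≠ c)
      have : List.filter (fun x => decide (x ≠ c)) [a, b] = [a, b] := by simp [hav, hbv]
      rw [this] at h1
      exact absurd (List.pairwise_iff_forall_sublist.1 H2 h1) (by omega)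
    · have h1 := h.filter (· ≠ v)
      have : List.filter (fun x => decide (x ≠ v)) [a, b, c] = [a, b, c] := by
        simp [hav, hbv, hcv]
      rw [this] at h1
      exact H1 a b c h1 hba hac

theorem count_le_iff (L : List ℕ) (v : ℕ) :
    (∀ x, L.count x ≤ 2) ↔ (∀ x, (L.filter (· ≠ v)).count x ≤ 2) ∧ L.count v ≤ 2 := by
  constructor
  · exact fun H => ⟨fun x => (List.Sublist.count_le x List.filter_sublist).trans (H x), H v⟩
  · rintro ⟨H1, H2⟩ x
    by_cases h : x = v
    · exact h ▸ H2
    · rw [← List.count_filter (p := (· ≠ v)) (by simpa using h)]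
      exact H1 x

theorem filter_ne_eq_self {A : List ℕ} {v : ℕ} (h : ∀ x ∈ A, x < v) : A.filter (· ≠ v) = A := by
  rw [List.filter_eq_self]
  intro a ha
  simpa using (h a ha).ne

theorem admissible_single_iff {A B : List ℕ} {v : ℕ} (hA : ∀ x ∈ A, x < v)
    (hB : ∀ x ∈ B, x < v) :
    Admissible (A ++ v :: B) ↔ Admissible (A ++ B) ∧ v ≤ A.length ∧ A.Pairwise (· ≤ ·) := by
  have hf : (A ++ v :: B).filter (· ≠ v) = A ++ B := by
    rw [List.filter_append, List.filter_cons_of_neg (by simp), filter_ne_eq_self hA,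
      filter_ne_eq_self hB]
  have hav := avoids_iff (fun x hx => (hA x hx).le) hB
  rw [hf, filter_ne_eq_self hA] at hav
  have hc := count_le_iff (A ++ v :: B) v
  rw [hf] at hc
  have hcv : (A ++ v :: B).count v ≤ 2 := by
    rw [List.count_append, List.count_cons_self, List.count_eq_zero_of_not_mem fun h => (hA v h).false,
      List.count_eq_zero_of_not_mem fun h => (hB v h).false]
    norm_num
  constructor
  · intro H
    have hv : v ≤ A.length := by
      have := H.le_index A.length (by simp)
      simpa using this
    obtain ⟨h1, h2⟩ := hav.1 H.avoids
    refine ⟨⟨?_, h1, (hc.1 H.count_le).1⟩, hv, h2⟩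
    rw [le_index_append_iff fun r hr => (hB r hr).le.trans hv]
    exact (le_index_append_iff (R := v :: B) (by
      simpa [hv] using fun r hr => (hB r hr).le.trans hv)).1 H.le_index
  · rintro ⟨H, hv, h2⟩
    refine ⟨?_, hav.2 ⟨H.avoids, h2⟩, hc.2 ⟨H.count_le, hcv⟩⟩
    rw [le_index_append_iff (R := v :: B) (by
      simpa [hv] using fun r hr => (hB r hr).le.trans hv)]
    exact (le_index_append_iff fun r hr => (hB r hr).le.trans hv).1 H.le_index

theorem admissible_double_iff {A B C : List ℕ} {v : ℕ} (hA : ∀ x ∈ A, x < v)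
    (hB : ∀ x ∈ B, x < v) (hC : ∀ x ∈ C, x < v) :
    Admissible (A ++ v :: (B ++ v :: C)) ↔
      Admissible (A ++ (B ++ C)) ∧ v ≤ A.length ∧ (A ++ B).Pairwise (· ≤ ·) := by
  have hf : (A ++ v :: (B ++ v :: C)).filter (· ≠ v) = A ++ (B ++ C) := by
    rw [List.filter_append, List.filter_cons_of_neg (by simp), List.filter_append,
      List.filter_cons_of_neg (by simp), filter_ne_eq_self hA, filter_ne_eq_self hB,
      filter_ne_eq_self hC]
  have hf' : (A ++ v :: B).filter (· ≠ v) = A ++ B := by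
    rw [List.filter_append, List.filter_cons_of_neg (by simp), filter_ne_eq_self hA,
      filter_ne_eq_self hB]
  have hav := avoids_iff (X := A ++ v :: B) (Y := C) (v := v) (by
    intro x hx
    rw [List.mem_append, List.mem_cons] at hx
    rcases hx with h | h | h
    · exact (hA x h).le
    · exact h.le
    · exact (hB x h).le) hC
  rw [List.append_assoc, List.cons_append, hf, hf'] at hav
  have hc := count_le_iff (A ++ v :: (B ++ v :: C)) v
  rw [hf] at hc
  have hcv : (A ++ v :: (B ++ v :: C)).count v ≤ 2 := by
    rw [List.count_append, List.count_cons_self, List.count_append, List.count_cons_self,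
      List.count_eq_zero_of_not_mem fun h => (hA v h).false,
      List.count_eq_zero_of_not_mem fun h => (hB v h).false,
      List.count_eq_zero_of_not_mem fun h => (hC v h).false]
  have hR : v ≤ A.length → ∀ r ∈ v :: (B ++ v :: C), r ≤ A.length := by
    intro hv r hr
    simp only [List.mem_cons, List.mem_append] at hr
    rcases hr with h | h | h | h
    · omega
    · exact (hB r h).le.trans hv
    · omega
    · exact (hC r h).le.trans hv
  have hR' : v ≤ A.length → ∀ r ∈ B ++ C, r ≤ A.length := by
    intro hv r hr
    refine hR hv r ?_
    simp only [List.mem_cons, List.mem_append] at hr ⊢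
    tauto
  constructor
  · intro H
    have hv : v ≤ A.length := by
      have := H.le_index A.length (by simp)
      simpa using this
    obtain ⟨h1, h2⟩ := hav.1 H.avoids
    refine ⟨⟨?_, h1, (hc.1 H.count_le).1⟩, hv, h2⟩
    rw [le_index_append_iff (hR' hv)]
    exact (le_index_append_iff (hR hv)).1 H.le_index
  · rintro ⟨H, hv, h2⟩
    refine ⟨?_, hav.2 ⟨H.avoids, h2⟩, hc.2 ⟨H.count_le, hcv⟩⟩
    rw [le_index_append_iff (hR hv)]
    exact (le_index_append_iff (hR' hv)).1 H.le_index

/-! ### Inserting a new maximum -/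

/-- Insert `v` after `g` letters of `L`; for `k = j + 1` insert a second `v` after `j` more letters
of `L`. -/
def insMax (L : List ℕ) (v g : ℕ) : ℕ → List ℕ
  | 0 => L.take g ++ v :: L.drop g
  | j + 1 => L.take g ++ v :: ((L.drop g).take j ++ v :: (L.drop g).drop j)

/-- The word without the occurrences of its maximum. -/
def parent (L : List ℕ) : List ℕ := L.filter (· ≠ bound L - 1)

/-- The admissible ways to insert a new maximum once or twice. -/
def choices (L : List ℕ) : Finset (Σ _ : ℕ, Σ _ : ℕ, ℕ) :=
  (Finset.Icc (bound L) (prefLen L)).sigma fun v =>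
    (Finset.Icc v (prefLen L)).sigma fun g => Finset.range (prefLen L - g + 2)

theorem exists_append_of_le {L : List ℕ} {g : ℕ} (h : g ≤ L.length) :
    ∃ A B, L = A ++ B ∧ A.length = g :=
  ⟨L.take g, L.drop g, (List.take_append_drop g L).symm, by simpa using h⟩

theorem take_append_append (A B C : List ℕ) :
    (A ++ (B ++ C)).take (A.length + B.length) = A ++ B := by
  rw [← List.append_assoc, ← List.length_append, List.take_left]

theorem insMax_zero_append (A B : List ℕ) (v : ℕ) :
    insMax (A ++ B) v A.length 0 = A ++ v :: B := by
  simp [insMax]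

theorem insMax_succ_append (A B C : List ℕ) (v : ℕ) :
    insMax (A ++ (B ++ C)) v A.length (B.length + 1) = A ++ v :: (B ++ v :: C) := by
  simp [insMax]

/-- Case distinction for an admissible insertion. -/
theorem insMax_cases {L : List ℕ} {v g k : ℕ} (h : ⟨v, g, k⟩ ∈ choices L) :
    (∀ x ∈ L, x < v) ∧ v ≤ g ∧ ((∃ A B, k = 0 ∧ L = A ++ B ∧ A.length = g ∧
        A.Pairwise (· ≤ ·) ∧ insMax L v g k = A ++ v :: B) ∨
      ∃ A B C, k = B.length + 1 ∧ L = A ++ (B ++ C) ∧ A.length = g ∧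
        (A ++ B).Pairwise (· ≤ ·) ∧ insMax L v g k = A ++ v :: (B ++ v :: C)) := by
  simp only [choices, Finset.mem_sigma, Finset.mem_Icc, Finset.mem_range] at h
  obtain ⟨⟨h1, h2⟩, ⟨h3, h4⟩, h5⟩ := h
  have hP := prefLen_le_length L
  refine ⟨(bound_le_iff _ _).1 h1, h3, ?_⟩
  match k, h5 with
  | 0, _ =>
    obtain ⟨A, B, rfl, rfl⟩ := exists_append_of_le (h4.trans hP)
    refine Or.inl ⟨A, B, rfl, rfl, rfl, ?_, insMax_zero_append A B v⟩
    rw [← pairwise_take_iff (h4.trans hP)] at h4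
    simpa using h4
  | j + 1, h5 =>
    obtain ⟨A, D, rfl, rfl⟩ := exists_append_of_le (h4.trans hP)
    obtain ⟨B, C, rfl, rfl⟩ := exists_append_of_le (L := D) (g := j) (by
      rw [List.length_append] at hP
      omega)
    refine Or.inr ⟨A, B, C, rfl, rfl, rfl, ?_, insMax_succ_append A B C v⟩
    have h6 : A.length + B.length ≤ prefLen (A ++ (B ++ C)) := by omega
    rwa [← pairwise_take_iff (h6.trans hP), take_append_append] at h6

theorem mem_insMax {L : List ℕ} {v g k x : ℕ} : x ∈ insMax L v g k ↔ x = v ∨ x ∈ L := by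
  match k with
  | 0 =>
    conv_rhs => rw [← List.take_append_drop g L]
    simp only [insMax, List.mem_append, List.mem_cons]
    tauto
  | j + 1 =>
    conv_rhs => rw [← List.take_append_drop g L, ← List.take_append_drop j (L.drop g)]
    simp only [insMax, List.mem_append, List.mem_cons]
    tauto

theorem bound_insMax {L : List ℕ} {v g k : ℕ} (h : ∀ x ∈ L, x < v) :
    bound (insMax L v g k) = v + 1 := by
  refine bound_eq (mem_insMax.2 (Or.inl rfl)) fun x hx => ?_
  rcases mem_insMax.1 hx with h1 | h1
  · exact h1.le
  · exact (h x h1).le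

theorem parent_insMax {L : List ℕ} {v g k : ℕ} (h : ∀ x ∈ L, x < v) :
    parent (insMax L v g k) = L := by
  rw [parent, bound_insMax h, Nat.add_sub_cancel]
  have hs : ∀ n, ∀ x ∈ L.take n, x < v := fun n x hx => h x (List.mem_of_mem_take hx)
  have hd : ∀ x ∈ L.drop g, x < v := fun x hx => h x (List.mem_of_mem_drop hx)
  match k with
  | 0 =>
    rw [insMax, List.filter_append, List.filter_cons_of_neg (by simp), filter_ne_eq_self (hs g),
      filter_ne_eq_self hd, List.take_append_drop]
  | j + 1 =>
    rw [insMax, List.filter_append, List.filter_cons_of_neg (by simp), List.filter_append,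
      List.filter_cons_of_neg (by simp), filter_ne_eq_self (hs g),
      filter_ne_eq_self fun x hx => hd x (List.mem_of_mem_take hx),
      filter_ne_eq_self fun x hx => hd x (List.mem_of_mem_drop hx), List.take_append_drop,
      List.take_append_drop]

theorem idxOf_append_cons {A B : List ℕ} {v : ℕ} (h : v ∉ A) :
    (A ++ v :: B).idxOf v = A.length := by
  rw [List.idxOf_append_of_notMem h, List.idxOf_cons_self, add_zero]

/-- The bound of the new word recovers `v`, the index of the first `v` recovers `g`, and the
presence and place of a second `v` recover `k`. -/
theorem insMax_injOn (L : List ℕ) :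
    Set.InjOn (fun p : Σ _ : ℕ, Σ _ : ℕ, ℕ => insMax L p.1 p.2.1 p.2.2) (choices L) := by
  rintro ⟨v, g, k⟩ h ⟨v', g', k'⟩ h' heq
  simp only at heq
  rw [Finset.mem_coe] at h h'
  obtain ⟨hv, -, hc⟩ := insMax_cases h
  obtain ⟨hv', -, hc'⟩ := insMax_cases h'
  obtain rfl : v = v' := by
    have := bound_insMax (g := g) (k := k) hv
    rw [heq, bound_insMax hv'] at this
    omega
  have hn : v ∉ L := fun hx => (hv v hx).false
  have idx : ∀ {g k}, ((∃ A B, k = 0 ∧ L = A ++ B ∧ A.length = g ∧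
        A.Pairwise (· ≤ ·) ∧ insMax L v g k = A ++ v :: B) ∨
      ∃ A B C, k = B.length + 1 ∧ L = A ++ (B ++ C) ∧ A.length = g ∧
        (A ++ B).Pairwise (· ≤ ·) ∧ insMax L v g k = A ++ v :: (B ++ v :: C)) →
      (insMax L v g k).idxOf v = g := by
    rintro g k (⟨A, B, -, rfl, rfl, -, e⟩ | ⟨A, B, C, -, rfl, rfl, -, e⟩) <;>
    · rw [e, idxOf_append_cons]
      simp only [List.mem_append, not_or] at hn
      tauto
  obtain rfl : g = g' := by rw [← idx hc, heq, idx hc']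
  suffices k = k' by rw [this]
  have hnd : v ∉ L.drop g := fun hx => hn (List.mem_of_mem_drop hx)
  have hnt : ∀ j, v ∉ (L.drop g).take j := fun j hx => hnd (List.mem_of_mem_take hx)
  have hj : ∀ {j}, ⟨v, g, j + 1⟩ ∈ choices L → ((L.drop g).take j).length = j := by
    intro j hj
    have hP := prefLen_le_length L
    simp only [choices, Finset.mem_sigma, Finset.mem_Icc, Finset.mem_range] at hj
    rw [List.length_take, List.length_drop]
    omega
  match k, k', h, h', heq with
  | 0, 0, _, _, _ => rfl
  | 0, j + 1, _, _, heq =>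
    have := List.append_cancel_left heq
    rw [(List.cons.inj this).2] at hnd
    simp at hnd
  | j + 1, 0, _, _, heq =>
    have := List.append_cancel_left heq
    rw [← (List.cons.inj this).2] at hnd
    simp at hnd
  | j + 1, j' + 1, h, h', heq =>
    have := (List.cons.inj (List.append_cancel_left heq)).2
    have h2 := congrArg (List.idxOf v) this
    rw [idxOf_append_cons (hnt j), idxOf_append_cons (hnt j'), hj h, hj h'] at h2
    rw [h2]

/-- The words obtained from `L` by inserting a new maximum. -/
def succs (L : List ℕ) : Finset (List ℕ) :=
  (choices L).image fun p => insMax L p.1 p.2.1 p.2.2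

theorem parent_of_mem_succs {L L' : List ℕ} (h : L' ∈ succs L) : parent L' = L := by
  obtain ⟨⟨v, g, k⟩, hp, rfl⟩ := Finset.mem_image.1 h
  exact parent_insMax (insMax_cases hp).1

theorem admissible_of_mem_succs {L L' : List ℕ} (hL : Admissible L) (h : L' ∈ succs L) :
    Admissible L' := by
  obtain ⟨⟨v, g, k⟩, hp, rfl⟩ := Finset.mem_image.1 h
  obtain ⟨hv, hvg, ⟨A, B, -, rfl, rfl, hs, e⟩ | ⟨A, B, C, -, rfl, rfl, hs, e⟩⟩ := insMax_cases hp
  · simp only [List.forall_mem_append] at hv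
    simp only [e]
    exact (admissible_single_iff hv.1 hv.2).2 ⟨hL, hvg, hs⟩
  · simp only [List.forall_mem_append] at hv
    simp only [e]
    exact (admissible_double_iff hv.1 hv.2.1 hv.2.2).2 ⟨hL, hvg, hs⟩

theorem exists_mem_succs {L' : List ℕ} (h : Admissible L') (h0 : L' ≠ []) :
    ∃ L, Admissible L ∧ L' ∈ succs L := by
  obtain ⟨v, hv, hle⟩ := exists_max h0
  obtain ⟨A, R, rfl, hA⟩ := List.eq_append_cons_of_mem hv
  have hA' : ∀ x ∈ A, x < v := fun x hx =>
    lt_of_le_of_ne (hle x (by simp [hx])) fun e => hA (e ▸ hx)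
  by_cases hR : v ∈ R
  · obtain ⟨B, C, rfl, hB⟩ := List.eq_append_cons_of_mem hR
    have hC : v ∉ C := by
      intro hC
      have h1 := h.count_le v
      have h2 := List.count_pos_iff.2 hC
      rw [List.count_append, List.count_cons_self, List.count_append, List.count_cons_self] at h1
      omega
    have hB' : ∀ x ∈ B, x < v := fun x hx =>
      lt_of_le_of_ne (hle x (by simp [hx])) fun e => hB (e ▸ hx)
    have hC' : ∀ x ∈ C, x < v := fun x hx =>
      lt_of_le_of_ne (hle x (by simp [hx])) fun e => hC (e ▸ hx)
    obtain ⟨h1, h2, h3⟩ := (admissible_double_iff hA' hB' hC').1 h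
    refine ⟨_, h1, Finset.mem_image.2 ⟨⟨v, A.length, B.length + 1⟩, ?_, insMax_succ_append A B C v⟩⟩
    have hb : bound (A ++ (B ++ C)) ≤ v := by
      rw [bound_le_iff]
      simp only [List.forall_mem_append]
      exact ⟨hA', hB', hC'⟩
    have hP : A.length + B.length ≤ prefLen (A ++ (B ++ C)) := by
      rwa [← pairwise_take_iff (by simp), take_append_append]
    simp only [choices, Finset.mem_sigma, Finset.mem_Icc, Finset.mem_range]
    omega
  · have hR' : ∀ x ∈ R, x < v := fun x hx =>
      lt_of_le_of_ne (hle x (by simp [hx])) fun e => hR (e ▸ hx)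
    obtain ⟨h1, h2, h3⟩ := (admissible_single_iff hA' hR').1 h
    refine ⟨_, h1, Finset.mem_image.2 ⟨⟨v, A.length, 0⟩, ?_, insMax_zero_append A R v⟩⟩
    have hb : bound (A ++ R) ≤ v := by
      rw [bound_le_iff]
      simp only [List.forall_mem_append]
      exact ⟨hA', hR'⟩
    have hP : A.length ≤ prefLen (A ++ R) := by
      rw [← pairwise_take_iff (by simp)]
      simpa using h3
    simp only [choices, Finset.mem_sigma, Finset.mem_Icc, Finset.mem_range]
    omega

theorem card_toFinset_of_mem_succs {L L' : List ℕ} (h : L' ∈ succs L) :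
    L'.toFinset.card = L.toFinset.card + 1 := by
  obtain ⟨⟨v, g, k⟩, hp, rfl⟩ := Finset.mem_image.1 h
  have hv := (insMax_cases hp).1
  have : (insMax L v g k).toFinset = insert v L.toFinset := by
    ext x
    simp [mem_insMax]
  rw [this, Finset.card_insert_of_notMem]
  simpa using fun hx => (hv v hx).false

/-- The number of admissible values for a new maximum, minus one. -/
def slack (L : List ℕ) : ℕ := prefLen L - bound L

/-- All letters of `L` are below `v`, so the increasing prefix ends right after the first `v`,
unless the second copy is adjacent to it, which is `k = 1`. -/
theorem prefLen_insMax {L : List ℕ} {v g k : ℕ} (h : ⟨v, g, k⟩ ∈ choices L) :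
    prefLen (insMax L v g k) = if k = 1 then g + 2 else g + 1 := by
  obtain ⟨hv, hvg, ⟨A, B, rfl, rfl, rfl, hs, e⟩ | ⟨A, B, C, rfl, rfl, rfl, hs, e⟩⟩ :=
    insMax_cases h
  · simp only [List.forall_mem_append] at hv
    rw [e, if_neg (by norm_num), ← List.singleton_append, ← List.append_assoc, prefLen_append]
    · simp
    · rw [List.pairwise_append]
      refine ⟨hs, by simp, ?_⟩
      simpa using fun a ha => (hv.1 a ha).le
    · intro b hb
      exact ⟨v, by simp, hv.2 b (List.mem_of_mem_head? hb)⟩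
  · simp only [List.forall_mem_append] at hv
    rw [List.pairwise_append] at hs
    match B, hv, hs, e with
    | [], hv, hs, e =>
      rw [e, if_pos (by simp), List.nil_append, ← List.singleton_append, ← List.singleton_append (l := C),
        ← List.append_assoc, ← List.append_assoc, prefLen_append]
      · simp
      · rw [List.pairwise_append, List.pairwise_append]
        have := fun a ha => (hv.1 a ha).le
        refine ⟨⟨hs.1, by simp, by simpa using this⟩, by simp, ?_⟩
        intro a ha b hb
        simp only [List.mem_append, List.mem_singleton] at ha hb
        rcases ha with ha | ha
        · exact hb ▸ this a ha
        · omega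
      · intro b hb
        exact ⟨v, by simp, hv.2.2 b (List.mem_of_mem_head? hb)⟩
    | b :: B, hv, hs, e =>
      rw [e, if_neg (by simp), ← List.singleton_append, ← List.append_assoc, prefLen_append]
      · simp
      · rw [List.pairwise_append]
        refine ⟨hs.1, by simp, ?_⟩
        simpa using fun a ha => (hv.1 a ha).le
      · intro a ha
        simp only [List.cons_append, List.head?_cons, Option.mem_def, Option.some.injEq] at ha
        exact ⟨v, by simp, hv.2.1 a (by simp [ha])⟩

/-- A nonempty word arises by an insertion with `v ≤ g`, so its bound `v + 1` is at most `g + 1`.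
Hence the subtraction in `slack` is never truncated. -/
theorem Admissible.bound_le {L : List ℕ} (h : Admissible L) : bound L ≤ prefLen L := by
  by_cases h0 : L = []
  · subst h0
    exact Nat.zero_le _
  · obtain ⟨M, -, hM⟩ := exists_mem_succs h h0
    obtain ⟨⟨v, g, k⟩, hp, rfl⟩ := Finset.mem_image.1 hM
    obtain ⟨hv, hvg, -⟩ := insMax_cases hp
    simp only [bound_insMax hv, prefLen_insMax hp]
    split_ifs <;> omega

/-! ### Counting -/

/-- The admissible words with `m` distinct letters. -/
def words : ℕ → Finset (List ℕ)
  | 0 => {[]}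
  | m + 1 => (words m).biUnion succs

theorem mem_words {m : ℕ} {L : List ℕ} :
    L ∈ words m ↔ Admissible L ∧ L.toFinset.card = m := by
  induction m generalizing L with
  | zero =>
    rw [words, Finset.mem_singleton, Finset.card_eq_zero, List.toFinset_eq_empty_iff]
    exact ⟨fun h => ⟨h ▸ admissible_nil, h⟩, And.right⟩
  | succ m ih =>
    rw [words, Finset.mem_biUnion]
    constructor
    · rintro ⟨M, hM, hL⟩
      rw [ih] at hM
      exact ⟨admissible_of_mem_succs hM.1 hL, by rw [card_toFinset_of_mem_succs hL, hM.2]⟩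
    · rintro ⟨hL, hc⟩
      have h0 : L ≠ [] := by
        rintro rfl
        simp at hc
      obtain ⟨M, hM, hL'⟩ := exists_mem_succs hL h0
      rw [card_toFinset_of_mem_succs hL'] at hc
      exact ⟨M, ih.2 ⟨hM, by omega⟩, hL'⟩

theorem sum_words_succ (m : ℕ) (φ : List ℕ → ℕ) :
    ∑ L ∈ words (m + 1), φ L = ∑ L ∈ words m, ∑ p ∈ choices L, φ (insMax L p.1 p.2.1 p.2.2) := by
  rw [words, Finset.sum_biUnion]
  · exact Finset.sum_congr rfl fun L _ => Finset.sum_image (insMax_injOn L)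
  · intro L _ M _ hne
    rw [Function.onFun, Finset.disjoint_left]
    intro L' h1 h2
    exact hne ((parent_of_mem_succs h1).symm.trans (parent_of_mem_succs h2))

theorem sum_Icc_tsub (F : ℕ → ℕ) {w P : ℕ} (h : w ≤ P) :
    ∑ v ∈ Finset.Icc w P, F (P - v) = psum F (P - w) := by
  rw [psum_eq_reflect, ← Finset.Ico_succ_right_eq_Icc, Finset.sum_Ico_eq_sum_range]
  have : Order.succ P - w = P - w + 1 := by
    rw [Nat.succ_eq_succ]
    omega
  rw [this]
  refine Finset.sum_congr rfl fun i _ => ?_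
  congr 1
  omega

/-- Here `u = prefLen L - v` and `d = g - v`. The three terms are the single insertion, the adjacent
pair, which gains one unit of slack, and the `u - d` separated pairs. -/
theorem sum_weight (f : ℕ → ℕ) (u : ℕ) :
    ∑ d ∈ Finset.range (u + 1), (f d + f (d + 1) + (u - d) * f d)
      = psum (fun d => psum f (d + 1)) u := by
  induction u with
  | zero => simp [psum, Finset.sum_range_succ]
  | succ u ih =>
    have h1 : psum (fun d => psum f (d + 1)) (u + 1)
        = psum (fun d => psum f (d + 1)) u + psum f (u + 1 + 1) := by
      rw [psum, Finset.sum_range_succ, ← psum]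
    have h2 : ∀ d ∈ Finset.range (u + 1), f d + f (d + 1) + (u + 1 - d) * f d
        = (f d + f (d + 1) + (u - d) * f d) + f d := by
      intro d hd
      rw [Finset.mem_range] at hd
      rw [show u + 1 - d = u - d + 1 by omega]
      ring
    have h3 : psum f (u + 1 + 1) = ∑ d ∈ Finset.range (u + 1), f d + f (u + 1) + f (u + 2) := by
      rw [psum, Finset.sum_range_succ, Finset.sum_range_succ]
    rw [Finset.sum_range_succ, Finset.sum_congr rfl h2, Finset.sum_add_distrib, ih, h1, h3]
    simp
    ring

theorem sum_choices_slack {L : List ℕ} (hL : bound L ≤ prefLen L) (f : ℕ → ℕ) :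
    ∑ p ∈ choices L, f (slack (insMax L p.1 p.2.1 p.2.2))
      = psum (psum fun d => psum f (d + 1)) (slack L) := by
  have h1 : ∀ p ∈ choices L, f (slack (insMax L p.1 p.2.1 p.2.2))
      = if p.2.2 = 1 then f (p.2.1 - p.1 + 1) else f (p.2.1 - p.1) := by
    rintro ⟨v, g, k⟩ hp
    obtain ⟨hv, hvg, -⟩ := insMax_cases hp
    rw [slack, prefLen_insMax hp, bound_insMax hv]
    dsimp only
    split_ifs
    · congr 1
      omega
    · congr 1
      omega
  rw [Finset.sum_congr rfl h1, choices, Finset.sum_sigma, slack, ← sum_Icc_tsub _ hL]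
  refine Finset.sum_congr rfl fun v hv => ?_
  rw [Finset.mem_Icc] at hv
  rw [Finset.sum_sigma, ← sum_weight, ← Finset.Ico_succ_right_eq_Icc,
    Finset.sum_Ico_eq_sum_range]
  have : Order.succ (prefLen L) - v = prefLen L - v + 1 := by
    rw [Nat.succ_eq_succ]
    omega
  rw [this]
  refine Finset.sum_congr rfl fun d hd => ?_
  rw [Finset.mem_range] at hd
  have e : prefLen L - (v + d) = prefLen L - v - d := by omega
  -- Splits off `k = 0` and `k = 1`; the remaining values of `k` all contribute `f d`.
  rw [Finset.sum_range_succ', Finset.sum_range_succ', e]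
  simp
  ring

theorem sum_words_slack (m : ℕ) (f : ℕ → ℕ) :
    ∑ L ∈ words m, f (slack L) = (fun f => psum (psum fun d => psum f (d + 1)))^[m] f 0 := by
  induction m generalizing f with
  | zero => simp [words, slack, bound, prefLen]
  | succ m ih =>
    rw [sum_words_succ m (fun L => f (slack L)), Function.iterate_succ_apply, ← ih]
    exact Finset.sum_congr rfl fun L hL => sum_choices_slack (mem_words.1 hL).1.bound_le f

/-- Regrouping only: two partial sums followed by the operator on the left are `stepOp` followed by
two partial sums. -/
theorem iterate_psum_psum (m : ℕ) (f : ℕ → ℕ) :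
    (fun f => psum (psum fun d => psum f (d + 1)))^[m] (psum (psum f))
      = psum (psum (stepOp^[m] f)) := by
  induction m generalizing f with
  | zero => rfl
  | succ m ih => exact ih (stepOp f)

theorem count_insMax {L : List ℕ} {v g k : ℕ} (h : ⟨v, g, k⟩ ∈ choices L) :
    (insMax L v g k).count v = if k = 0 then 1 else 2 := by
  obtain ⟨hv, -, ⟨A, B, rfl, rfl, rfl, -, e⟩ | ⟨A, B, C, rfl, rfl, rfl, -, e⟩⟩ := insMax_cases h
  · simp only [List.forall_mem_append] at hv
    rw [e, List.count_append, List.count_cons_self,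
      List.count_eq_zero_of_not_mem fun h => (hv.1 v h).false,
      List.count_eq_zero_of_not_mem fun h => (hv.2 v h).false]
    rfl
  · simp only [List.forall_mem_append] at hv
    rw [e, List.count_append, List.count_cons_self, List.count_append, List.count_cons_self,
      List.count_eq_zero_of_not_mem fun h => (hv.1 v h).false,
      List.count_eq_zero_of_not_mem fun h => (hv.2.1 v h).false,
      List.count_eq_zero_of_not_mem fun h => (hv.2.2 v h).false]
    rfl

/-- The last maximum is inserted once, so only the pairs `v ≤ g` are counted. Their number is the
double partial sum of `1` at the slack, to which `iterate_psum_psum` applies. -/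
theorem card_words_count_max (m : ℕ) :
    ((words (m + 1)).filter fun L => L.count (bound L - 1) = 1).card
      = stepOp^[m] (fun _ => 1) 0 := by
  have h2 : stepOp^[m] (fun _ => 1) 0 = psum (psum (stepOp^[m] (fun _ => 1))) 0 := by
    simp [psum]
  rw [Finset.card_filter, sum_words_succ, h2, ← iterate_psum_psum, ← sum_words_slack]
  refine Finset.sum_congr rfl fun L hL => ?_
  have hb := (mem_words.1 hL).1.bound_le
  have h1 : ∀ p ∈ choices L, (if (insMax L p.1 p.2.1 p.2.2).count
      (bound (insMax L p.1 p.2.1 p.2.2) - 1) = 1 then 1 else 0) = if p.2.2 = 0 then 1 else 0 := by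
    rintro ⟨v, g, k⟩ hp
    dsimp only
    rw [bound_insMax (insMax_cases hp).1, Nat.add_sub_cancel, count_insMax hp]
    split_ifs <;> simp_all
  rw [Finset.sum_congr rfl h1, choices, Finset.sum_sigma, slack, ← sum_Icc_tsub _ hb]
  refine Finset.sum_congr rfl fun v hv => ?_
  rw [Finset.mem_Icc] at hv
  rw [Finset.sum_sigma, ← sum_Icc_tsub _ hv.2]
  refine Finset.sum_congr rfl fun g _ => ?_
  rw [Finset.sum_range_succ']
  simp

end InvSeq

/-! ### From functions to words -/

namespace InvSeq

theorem triple_sublist_ofFn_iff {n : ℕ} (e : Fin n → ℕ) (a b c : ℕ) :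
    [a, b, c].Sublist (List.ofFn e) ↔
      ∃ f : Fin 3 → Fin n, StrictMono f ∧ e (f 0) = a ∧ e (f 1) = b ∧ e (f 2) = c := by
  constructor
  · intro h
    obtain ⟨f, hf⟩ := List.sublist_iff_exists_fin_orderEmbedding_get_eq.1 h
    refine ⟨fun i => Fin.cast List.length_ofFn (f i), fun i j hij => ?_, ?_, ?_, ?_⟩
    · exact f.strictMono hij
    · exact (List.get_ofFn e _).symm.trans (hf 0).symm
    · exact (List.get_ofFn e _).symm.trans (hf 1).symm
    · exact (List.get_ofFn e _).symm.trans (hf 2).symm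
  · rintro ⟨f, hf, rfl, rfl, rfl⟩
    have h := List.map_getElem_sublist (l := List.ofFn e)
      (is := (List.ofFn f).map (Fin.cast List.length_ofFn.symm)) (by
        rw [List.pairwise_map, List.pairwise_ofFn]
        exact fun i j hij => hf hij)
    simpa using h

theorem lt_of_reduction_lt {k : ℕ} {u : Fin k → ℕ} {a b : Fin k}
    (h : reduction u a < reduction u b) : u a < u b := by
  by_contra! hle
  refine absurd h (not_lt.2 (Finset.card_le_card fun x hx => ?_))
  rw [Finset.mem_filter] at hx ⊢
  exact ⟨hx.1, hx.2.trans_le hle⟩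

theorem reduction_lt_of_lt {k : ℕ} {u : Fin k → ℕ} {a b : Fin k} (h : u a < u b) :
    reduction u a < reduction u b := by
  refine Finset.card_lt_card (Finset.ssubset_iff_of_subset (fun x hx => ?_) |>.2 ⟨u a, ?_, ?_⟩)
  · rw [Finset.mem_filter] at hx ⊢
    exact ⟨hx.1, hx.2.trans h⟩
  · simpa using h
  · simp

theorem reduction_lt {k : ℕ} (u : Fin k → ℕ) (a : Fin k) : reduction u a < k := by
  have h1 : reduction u a < (Finset.univ.image u).card :=
    Finset.card_lt_card (Finset.filter_ssubset.2 ⟨u a, by simp, lt_irrefl _⟩)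
  exact h1.trans_le (Finset.card_image_le.trans (by simp))

theorem reduction_eq_102_iff (u : Fin 3 → ℕ) :
    reduction u = ![1, 0, 2] ↔ u 1 < u 0 ∧ u 0 < u 2 := by
  constructor
  · intro h
    exact ⟨lt_of_reduction_lt (by simp [h]), lt_of_reduction_lt (by simp [h])⟩
  · rintro ⟨h1, h2⟩
    have i1 := reduction_lt_of_lt h1
    have i2 := reduction_lt_of_lt h2
    -- With `i1` and `i2` this gives a strict chain of three values below `3`, which must be `0`,
    -- `1`, `2`.
    have i3 := reduction_lt u 2
    ext i
    fin_cases i <;> simp <;> omega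

theorem reduction_eq_000_iff (u : Fin 3 → ℕ) :
    reduction u = ![0, 0, 0] ↔ u 0 = u 1 ∧ u 1 = u 2 := by
  constructor
  · intro h
    have key : ∀ a b, u a ≤ u b := by
      intro a b
      by_contra! hlt
      have h0 := reduction_lt_of_lt hlt
      rw [h] at h0
      revert h0
      fin_cases a <;> fin_cases b <;> simp
    exact ⟨le_antisymm (key _ _) (key _ _), le_antisymm (key _ _) (key _ _)⟩
  · rintro ⟨h1, h2⟩
    ext i
    have : reduction u i = 0 := by
      rw [reduction, Finset.card_eq_zero, Finset.filter_eq_empty_iff]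
      intro x hx
      obtain ⟨j, -, rfl⟩ := Finset.mem_image.1 hx
      fin_cases i <;> fin_cases j <;> simp <;> omega
    rw [this]
    fin_cases i <;> rfl

theorem avoids_102_iff {n : ℕ} (e : Fin n → ℕ) :
    Avoids ![1, 0, 2] e ↔ ∀ a b c, [a, b, c].Sublist (List.ofFn e) → b < a → a < c → False := by
  simp only [Avoids, Contains, reduction_eq_102_iff, triple_sublist_ofFn_iff]
  constructor
  · rintro H a b c ⟨f, hf, rfl, rfl, rfl⟩ h1 h2
    exact H ⟨f, hf, h1, h2⟩
  · rintro H ⟨f, hf, h1, h2⟩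
    exact H _ _ _ ⟨f, hf, rfl, rfl, rfl⟩ h1 h2

theorem avoids_000_iff {n : ℕ} (e : Fin n → ℕ) :
    Avoids ![0, 0, 0] e ↔ ∀ x, (List.ofFn e).count x ≤ 2 := by
  have h : ∀ x, (List.ofFn e).count x ≤ 2 ↔ ¬ [x, x, x].Sublist (List.ofFn e) := by
    intro x
    have := List.replicate_sublist_iff (n := 3) (a := x) (l := List.ofFn e)
    rw [show [x, x, x] = List.replicate 3 x from rfl, this]
    omega
  simp only [h, Avoids, Contains, reduction_eq_000_iff, triple_sublist_ofFn_iff]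
  constructor
  · rintro H x ⟨f, hf, h1, h2, h3⟩
    exact H ⟨f, hf, h1.trans h2.symm, h2.trans h3.symm⟩
  · rintro H ⟨f, hf, h1, h2⟩
    exact H _ ⟨f, hf, rfl, h1.symm, (h1.trans h2).symm⟩

theorem mem_IS102000_iff {n : ℕ} (e : Fin n → ℕ) :
    e ∈ IS102000 n ↔ Admissible (List.ofFn e) := by
  have h : IsInversionSeq e ↔
      ∀ (i : ℕ) (hi : i < (List.ofFn e).length), (List.ofFn e)[i] ≤ i := by
    constructor
    · intro H i hi
      rw [List.getElem_ofFn]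
      exact H _
    · intro H i
      simpa using H i (by simp)
  rw [IS102000, Set.mem_ofPred_eq, h, avoids_102_iff, avoids_000_iff]
  exact ⟨fun H => ⟨H.1, H.2.1, H.2.2⟩, fun H => ⟨H.1, H.2, H.3⟩⟩

theorem dist_eq_card_toFinset {n : ℕ} (e : Fin n → ℕ) :
    dist e = (List.ofFn e).toFinset.card := by
  rw [dist]
  congr 1
  ext x
  simp

theorem count_ofFn {n : ℕ} (e : Fin n → ℕ) (v : ℕ) :
    (List.ofFn e).count v = (Finset.univ.filter fun i => e i = v).card := by
  induction n with
  | zero => simp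
  | succ n ih =>
    rw [List.ofFn_succ, List.count_cons, ih, Fin.card_filter_univ_succ]
    simp only [beq_iff_eq]
    split_ifs <;> rfl

theorem card_maxPositions {n : ℕ} (e : Fin n → ℕ) (h : n ≠ 0) :
    (maxPositions e).card = (List.ofFn e).count (bound (List.ofFn e) - 1) := by
  obtain ⟨v, hv, hle⟩ := exists_max (L := List.ofFn e) (by simpa using h)
  rw [bound_eq hv hle, Nat.add_sub_cancel, count_ofFn, maxPositions]
  congr 1
  ext p
  obtain ⟨q, rfl⟩ := (List.mem_ofFn' _ _).1 hv
  simp only [Finset.mem_filter, Finset.mem_univ, true_and]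
  have hle' : ∀ i, e i ≤ e q := fun i => hle _ (by simp)
  exact ⟨fun H => le_antisymm (hle' p) (H q), fun H i => H ▸ hle' i⟩

theorem ncard_maxOnceSeqs_succ (m : ℕ) :
    (maxOnceSeqs (m + 1)).ncard = stepOp^[m] (fun _ => 1) 0 := by
  rw [← card_words_count_max, ← Set.ncard_coe_finset,
    ← Set.ncard_image_of_injective _ (List.equivSigmaTuple (α := ℕ)).symm.injective]
  congr 1
  ext L
  rw [Equiv.image_eq_preimage_symm, Equiv.symm_symm, Set.mem_preimage]
  obtain ⟨⟨n, e⟩, rfl⟩ := (List.equivSigmaTuple (α := ℕ)).symm.surjective L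
  rw [Equiv.apply_symm_apply, List.equivSigmaTuple_symm_apply, Finset.mem_coe, Finset.mem_filter,
    mem_words, maxOnceSeqs, Set.mem_ofPred_eq, mem_IS102000_iff, dist_eq_card_toFinset, and_assoc]
  refine and_congr_right fun _ => and_congr_right fun hc => ?_
  -- A word with `m + 1` distinct letters is not empty, so the convention in `MaxOnce` plays no
  -- role.
  have h : n ≠ 0 := by
    rintro rfl
    simp at hc
  rw [MaxOnce, card_maxPositions e h]
  simp [h]

theorem ncard_maxOnceSeqs_zero : (maxOnceSeqs 0).ncard = 1 := by
  rw [Set.ncard_eq_one]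
  refine ⟨⟨0, Fin.elim0⟩, ?_⟩
  ext ⟨n, e⟩
  rw [maxOnceSeqs, Set.mem_ofPred_eq, mem_IS102000_iff, dist_eq_card_toFinset,
    Set.mem_singleton_iff]
  constructor
  · rintro ⟨-, h, -⟩
    have hn : n = 0 := by simpa using h
    subst hn
    congr 1
    exact Subsingleton.elim _ _
  · intro h
    obtain rfl : n = 0 := congrArg Sigma.fst h
    exact ⟨by simpa using admissible_nil, by simp, Or.inl rfl⟩

end InvSeq

theorem mainTheorem4 (m : ℕ) :
    ((⋃ n ∈ Set.Icc m (2 * m), HPath.pathsB n m).ncard : ℚ)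
        = 1 / (3 * (m : ℚ) + 1) * ((4 * m).choose m : ℚ) ∧
    ((InvSeq.maxOnceSeqs m).ncard : ℚ)
        = 1 / (3 * (m : ℚ) + 1) * ((4 * m).choose m : ℚ) := by
  match m with
  | 0 =>
    rw [HPath.ncard_iUnion_pathsB_zero, InvSeq.ncard_maxOnceSeqs_zero]
    norm_num
  | r + 1 =>
    rw [HPath.ncard_iUnion_pathsB_succ, InvSeq.ncard_maxOnceSeqs_succ]
    exact ⟨iterate_stepOp_one r, iterate_stepOp_one r⟩
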